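/- Let $W=(W_t)_{t\ge 0}$ be a standard Brownian motion with continuous paths on a probability space $(\Omega,\mathcal F,\mathbb P)$, let $\tau$ be a random variable with values in $(0,\infty)$ and law $\mathbb P_\tau$, and let $Z$ be a random variable with $\mathbb P(Z=z_i)=p_i$, $i=1,2$, where $z_1\neq z_2$ are real numbers and $p_1+p_2=1$. Assume that $\tau$, $Z$ and $W$ are independent. Define the Brownian bridge information process $$\xi_t=W_{t\wedge\tau}-\frac{t\wedge\tau}{\tau}W_\tau+\frac{t\wedge\tau}{\tau}Z,\qquad t\ge 0,$$ and let $\mathbb F^\xi=(\mathcal F^\xi_t)_{t\ge0}$, $\mathcal F^\xi_t=\sigma(\xi_s,\,s\le t)$, be its natural filtration. Write $p(t,x,m)$ for the density at $x$ of the normal law with mean $m$ and variance $t$, $p(t,x)=p(t,x,0)$, and, for $0<t<r$ and $x,z\in\mathbb R$, $$\varphi_t^{r,z}(x)=p\Big(\tfrac{t(r-t)}{r},\,x,\,\tfrac tr z\Big),\qquad D_t(x)=\sum_{i=1}^2p_i\int_{(t,\infty)}\varphi_t^{r,z_i}(x)\,\mathbb P_\tau(dr).$$ Then $\xi$ is an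 $\mathbb F^\xi$-Markov process: for all $0\le s\le t$ and every bounded Borel function $g$, $\mathbb E[g(\xi_t)\mid\mathcal F^\xi_s]=\mathbb E[g(\xi_t)\mid\xi_s]$ almost surely. Moreover, for all $0<t<u$ and for $\mathbb P_{\xi_t}$-almost every $x$, its transition law is $$\begin{aligned}\mathbb P(\xi_u\in dy\mid\xi_t=x)=\Bigg[&\sum_{i=1}^2\bigg(\mathbb I_{\{x=z_i\}}+\frac{p_i\int_{(t,u]}\varphi_t^{r,z_i}(x)\,\mathbb P_\tau(dr)}{D_t(x)}\,\mathbb I_{\{x\ne z_1\}}\mathbb I_{\{x\neq z_2\}}\bigg)\mathbb I_{\{y=z_i\}}\\&+p(u-t,y-x)\,\frac{p(t,x)}{p(u,y)}\,\frac{D_u(y)}{D_t(x)}\,\mathbb I_{\{x\ne z_1\}}\mathbb I_{\{x\ne z_2\}}\mathbb I_{\{y\neq z_1\}}\mathbb I_{\{y\ne z_2\}}\Bigg]\mu(dy),\end{aligned}$$ where $\mu=\delta_{z_1}+\delta_{z_2}+dy$. (This is a family of kernels indexed by the two times $t<u$.) -/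

import Mathlib

open MeasureTheory ProbabilityTheory Set
open scoped NNReal ENNReal

noncomputable section

/-- Brownian bridge with random length `τ` and random pinning point `Z` associated to `W`:
`W_{t ∧ τ} - (t ∧ τ) / τ * W_τ + (t ∧ τ) / τ * Z`. -/
def brownianBridge {Ω : Type*} (W : ℝ≥0 → Ω → ℝ) (τ : Ω → ℝ≥0) (Z : Ω → ℝ)
    (t : ℝ≥0) (ω : Ω) : ℝ :=
  W (min t (τ ω)) ω - ((min t (τ ω) : ℝ≥0) : ℝ) / (τ ω : ℝ) * W (τ ω) ω
    + ((min t (τ ω) : ℝ≥0) : ℝ) / (τ ω : ℝ) * Z ω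

/-- The bridge at time `t` is a random variable when `W` has measurable marginals and
continuous paths; needed to speak of its natural filtration. -/
theorem measurable_brownianBridge {Ω : Type*} [MeasurableSpace Ω]
    {W : ℝ≥0 → Ω → ℝ} {τ : Ω → ℝ≥0} {Z : Ω → ℝ}
    (hWm : ∀ t, Measurable (W t)) (hWc : ∀ ω, Continuous (fun t => W t ω))
    (hτ : Measurable τ) (hZ : Measurable Z) (t : ℝ≥0) :
    Measurable (brownianBridge W τ Z t) := by
  have hW : Measurable (Function.uncurry W) :=
    measurable_uncurry_of_continuous_of_measurable hWc hWm
  have hm : Measurable (fun ω => min t (τ ω)) := measurable_const.min hτ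
  have h1 : Measurable (fun ω => W (min t (τ ω)) ω) := hW.comp (hm.prodMk measurable_id)
  have h2 : Measurable (fun ω => W (τ ω) ω) := hW.comp (hτ.prodMk measurable_id)
  unfold brownianBridge
  fun_prop

/-- `X` is a Markov process with respect to the filtration `ℱ`: it is adapted and, for all
`s ≤ t` and all bounded Borel functions `g`, `E[g (X_t) | ℱ_s] = E[g (X_t) | X_s]` a.s. -/
def IsMarkovProcess {Ω : Type*} {m : MeasurableSpace Ω} (ℱ : Filtration ℝ≥0 m)
    (X : ℝ≥0 → Ω → ℝ) (P : Measure Ω) : Prop :=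
  Adapted ℱ X ∧
    ∀ s t : ℝ≥0, s ≤ t → ∀ g : ℝ → ℝ, Measurable g → (∃ C : ℝ, ∀ x, |g x| ≤ C) →
      P[fun ω => g (X t ω) | ℱ s] =ᵐ[P]
        P[fun ω => g (X t ω) | MeasurableSpace.comap (X s) inferInstance]

/-- For `0 < t < r`, the density at `x` of the Brownian bridge of deterministic length `r` and
pinning point `z` at time `t`: Gaussian with mean `(t / r) z` and variance `t (r - t) / r`. -/
def bridgePDF (r : ℝ≥0) (z : ℝ) (t : ℝ≥0) (x : ℝ) : ℝ≥0∞ :=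
  gaussianPDF ((t : ℝ) / (r : ℝ) * z) (t * (r - t) / r) x

/-- `∑ i, p i * ∫_{(t, ∞)} φ_t^{r, z i} (x) ν(dr)`, where `φ_t^{r, z}` is the bridge density. -/
def aliveDensity (ν : Measure ℝ≥0) (z : Fin 2 → ℝ) (p : Fin 2 → ℝ≥0) (t : ℝ≥0) (x : ℝ) :
    ℝ≥0∞ :=
  ∑ i, (p i : ℝ≥0∞) * ∫⁻ r in Ioi t, bridgePDF r (z i) t x ∂ν

open Classical in
/-- Transition density of the Brownian bridge information process from `x` at time `t` to `y`
at time `u`, with respect to `δ_{z 0} + δ_{z 1} + dy`; `ν` is the law of the length, and `p i` is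
the probability of the pinning point `z i`. -/
def transitionDensity (ν : Measure ℝ≥0) (z : Fin 2 → ℝ) (p : Fin 2 → ℝ≥0)
    (t u : ℝ≥0) (x y : ℝ) : ℝ≥0∞ :=
  (∑ i, ((if x = z i then 1 else 0)
      + (if x ≠ z 0 ∧ x ≠ z 1 then
          (p i : ℝ≥0∞) * (∫⁻ r in Ioc t u, bridgePDF r (z i) t x ∂ν) / aliveDensity ν z p t x
        else 0))
    * (if y = z i then 1 else 0))
  + (if x ≠ z 0 ∧ x ≠ z 1 ∧ y ≠ z 0 ∧ y ≠ z 1 then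
      gaussianPDF 0 (u - t) (y - x) * (gaussianPDF 0 t x / gaussianPDF 0 u y)
        * (aliveDensity ν z p u y / aliveDensity ν z p t x)
    else 0)

end

/-! Fix the length `r` and the pinning point. For `u ≤ s ≤ r` the bridge equals `W_u - (u/s) W_s`
plus `u/s` times its value at `s`. The first term is Gaussian and uncorrelated with `(W_v)`, `v ≥
s`, hence independent of it, while the values at `s` and at any `t` in `[s, r]` are functions of
that future (`lintegral_brownianBridge_const_mul`). So, given those values, a functional of the path
on `[0, s]` has expectation `H(ξ_s)`, where `H` depends neither on `r` nor on the pinning point. The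
past therefore says nothing about length and pinning point beyond `ξ_s`, and this survives mixing
over them.

On `{τ > s}`, mixing gives `ξ_s` the density `D_s` and turns the pair (past, `ξ_t`) into `∫ H(x) N
g(x) dx`, where `N` is `transitionNumerator`; the kernel is thus `N g / D_s`. On `{τ ≤ s}` the
process already sits at `Z`, and the kernel is a Dirac mass. The value `ξ_s` tells the two cases
apart almost surely, because a law with a density does not charge the pinning points. The resulting
identity, tested against all functionals of the past, yields the Markov property, and tested against
functions of `ξ_s`, the transition law. -/

noncomputable section

namespace BrownianBridge

/-! ### Bridges of deterministic length and pinning point. -/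

section FixedLength

variable {Ω : Type*} {W : ℝ≥0 → Ω → ℝ}

theorem brownianBridge_const_of_le {r t : ℝ≥0} (h : t ≤ r) (z : ℝ) (ω : Ω) :
    brownianBridge W (fun _ => r) (fun _ => z) t ω
      = W t ω - (t : ℝ) / r * W r ω + (t : ℝ) / r * z := by
  simp [brownianBridge, h]

theorem brownianBridge_of_ge {τ : Ω → ℝ≥0} {Z : Ω → ℝ} {t : ℝ≥0} {ω : Ω} (hpos : 0 < τ ω)
    (h : τ ω ≤ t) : brownianBridge W τ Z t ω = Z ω := by
  have : (τ ω : ℝ) ≠ 0 := by exact_mod_cast hpos.ne'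
  simp [brownianBridge, h, this]

/-- A bridge of length `r` restricted to `[0, s]` is a bridge of length `s` pinned at its value
at time `s`. -/
theorem brownianBridge_const_eq_brownianBridge_const {r s t : ℝ≥0} (hs : 0 < s) (hsr : s ≤ r)
    (hts : t ≤ s) (z : ℝ) (ω : Ω) :
    brownianBridge W (fun _ => r) (fun _ => z) t ω
      = brownianBridge W (fun _ => s)
          (fun _ => brownianBridge W (fun _ => r) (fun _ => z) s ω) t ω := by
  rw [brownianBridge_const_of_le hts, brownianBridge_const_of_le (hts.trans hsr),
    brownianBridge_const_of_le hsr]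
  have hs' : (s : ℝ) ≠ 0 := by exact_mod_cast hs.ne'
  have hr' : (r : ℝ) ≠ 0 := by exact_mod_cast (hs.trans_le hsr).ne'
  field_simp
  ring

variable [mΩ : MeasurableSpace Ω] {P : Measure Ω}

/-- The expectation of a functional of two independent variables is an iterated integral. -/
theorem lintegral_indepFun_eq_lintegral_lintegral [IsFiniteMeasure P] {E F : Type*}
    [MeasurableSpace E] [MeasurableSpace F] {X : Ω → E} {Y : Ω → F} (hXY : IndepFun X Y P)
    (hX : Measurable X) (hY : Measurable Y) {f : E × F → ℝ≥0∞} (hf : Measurable f) :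
    ∫⁻ ω, f (X ω, Y ω) ∂P = ∫⁻ x, ∫⁻ ω, f (x, Y ω) ∂P ∂(P.map X) := by
  rw [← lintegral_map (f := f) (g := fun ω => (X ω, Y ω)) hf (hX.prodMk hY),
    (indepFun_iff_map_prod_eq_prod_map_map hX.aemeasurable hY.aemeasurable).1 hXY,
    lintegral_prod _ hf.aemeasurable]
  refine lintegral_congr fun x => ?_
  exact lintegral_map (hf.comp measurable_prodMk_left) hY

/-- The bridge of length `s` built from `W` is independent of the future of `W` after `s`. -/
theorem indepFun_sub_div_mul (hW : IsPreBrownianReal W P) {s : ℝ≥0} (hs : 0 < s) :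
    IndepFun (fun ω (u : Iic s) => W u ω - ((u : ℝ≥0) : ℝ) / s * W s ω)
      (fun ω (v : Ici s) => W v ω) P := by
  classical
  have mW t := hW.aemeasurable t
  have hs' : (s : ℝ) ≠ 0 := by exact_mod_cast hs.ne'
  -- The two families are jointly Gaussian, and for `u ≤ s ≤ t` the covariance is `u - (u/s) s = 0`.
  apply IsGaussianProcess.indepFun_of_covariance_eq_zero
  · apply hW.isGaussianProcess.of_isGaussianProcess
    rintro (⟨u, hu⟩ | ⟨t, ht⟩)
    · exact ⟨{u, s},
        { toFun x := x ⟨u, by simp⟩ - (u : ℝ) / s * x ⟨s, by simp⟩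
          map_add' x y := by simp; ring
          map_smul' c x := by simp; ring }, by simp⟩
    · exact ⟨{t},
        { toFun x := x ⟨t, by simp⟩
          map_add' x y := by simp
          map_smul' c x := by simp }, by simp⟩
  any_goals fun_prop
  · rintro ⟨u, hu : u ≤ s⟩ ⟨t, ht : s ≤ t⟩
    have := hW.isGaussianProcess.isProbabilityMeasure
    have hL (v : ℝ≥0) : MemLp (W v) 2 P := (hW.isGaussianProcess.hasGaussianLaw_eval v).memLp_two
    rw [covariance_fun_sub_left (hL _) ((hL _).const_mul _) (hL _), covariance_const_mul_left,
      hW.covariance_eval, hW.covariance_eval, min_eq_left (hu.trans ht), min_eq_left ht]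
    field_simp
    simp

theorem measurable_brownianBridge_const (hWm : ∀ t, Measurable (W t)) (r : ℝ≥0) (z : ℝ)
    (t : ℝ≥0) : Measurable (brownianBridge W (fun _ => r) (fun _ => z) t) := by
  change Measurable fun ω => W (min t r) ω - ((min t r : ℝ≥0) : ℝ) / (r : ℝ) * W r ω
    + ((min t r : ℝ≥0) : ℝ) / (r : ℝ) * z
  fun_prop

/-- The law of a bridge of fixed length and pinning point at a time before its length. -/
theorem map_brownianBridge_const (hW : IsPreBrownianReal W P) (hWm : ∀ t, Measurable (W t))
    {r s : ℝ≥0} (hs : 0 < s) (hsr : s < r) (z : ℝ) :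
    P.map (brownianBridge W (fun _ => r) (fun _ => z) s)
      = volume.withDensity (bridgePDF r z s) := by
  classical
  have := hW.isGaussianProcess.isProbabilityMeasure
  have hr' : (r : ℝ) ≠ 0 := by exact_mod_cast (hs.trans hsr).ne'
  have hL (v : ℝ≥0) : MemLp (W v) 2 P := (hW.isGaussianProcess.hasGaussianLaw_eval v).memLp_two
  have hG : HasGaussianLaw (fun ω => W s ω - (s : ℝ) / r * W r ω) P := by
    have : IsGaussianProcess (fun (_ : Unit) ω => W s ω - (s : ℝ) / r * W r ω) P := by
      apply hW.isGaussianProcess.of_isGaussianProcess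
      rintro -
      exact ⟨{s, r},
        { toFun x := x ⟨s, by simp⟩ - (s : ℝ) / r * x ⟨r, by simp⟩
          map_add' x y := by simp; ring
          map_smul' c x := by simp; ring }, by simp⟩
    exact this.hasGaussianLaw_eval ()
  have hvar : s * (r - s) / r ≠ 0 := by
    have : 0 < r - s := tsub_pos_of_lt hsr
    have := hs.trans hsr
    positivity
  have hlaw : HasLaw (fun ω => W s ω - (s : ℝ) / r * W r ω)
      (gaussianReal 0 (s * (r - s) / r)) P := by
    refine ⟨by fun_prop, ?_⟩
    rw [hG.map_eq_gaussianReal]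
    congr
    · rw [integral_sub ((hL _).integrable (by norm_num))
        (((hL _).integrable (by norm_num)).const_mul _), integral_const_mul,
        hW.integral_eval, hW.integral_eval]
      simp
    · rw [variance_fun_sub (hL _) ((hL _).const_mul _), variance_const_mul,
        covariance_const_mul_right, ← covariance_self (hWm s).aemeasurable,
        ← covariance_self (hWm r).aemeasurable, hW.covariance_eval, hW.covariance_eval,
        hW.covariance_eval, min_self, min_self, min_eq_left hsr.le]
      ext
      rw [Real.coe_toNNReal']
      push_cast [NNReal.coe_sub hsr.le]
      have : (s : ℝ) - 2 * ((s : ℝ) / r * s) + ((s : ℝ) / r) ^ 2 * r = s * (r - s) / r := by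
        field_simp
        ring
      rw [this, max_eq_left]
      have : (0 : ℝ) ≤ r - s := by simpa using hsr.le
      positivity
  have h2 := (gaussianReal_add_const hlaw ((s : ℝ) / r * z)).map_eq
  rw [zero_add, gaussianReal_of_var_ne_zero _ hvar] at h2
  have h3 : brownianBridge W (fun _ => r) (fun _ => z) s
      = fun ω => W s ω - (s : ℝ) / r * W r ω + (s : ℝ) / r * z :=
    funext fun ω => brownianBridge_const_of_le hsr.le z ω
  rw [h3, h2]
  rfl

/-- The expectation of a functional of the path on `[0, s]` of a bridge of length `s` pinned at
`x`. -/
def bridgeExpectation (P : Measure Ω) (W : ℝ≥0 → Ω → ℝ) (s : ℝ≥0) (h : (Iic s → ℝ) → ℝ≥0∞)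
    (x : ℝ) : ℝ≥0∞ :=
  ∫⁻ ω, h (fun u => brownianBridge W (fun _ => s) (fun _ => x) u ω) ∂P

theorem measurable_bridgeExpectation [SFinite P] (hWm : ∀ t, Measurable (W t)) {s : ℝ≥0}
    {h : (Iic s → ℝ) → ℝ≥0∞} (hh : Measurable h) : Measurable (bridgeExpectation P W s h) := by
  refine Measurable.lintegral_prod_right' (f := fun q : ℝ × Ω =>
    h (fun u => brownianBridge W (fun _ => s) (fun _ => q.1) u q.2)) (hh.comp ?_)
  refine measurable_pi_lambda _ fun u => ?_
  simp only [brownianBridge]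
  fun_prop

/-- Conditionally on its values at times `s ≤ t`, a bridge of length `r ≥ t` is on `[0, s]` a
bridge of length `s`. -/
theorem lintegral_brownianBridge_const_mul (hW : IsPreBrownianReal W P)
    (hWm : ∀ t, Measurable (W t)) {r s t : ℝ≥0} (hs : 0 < s) (hst : s ≤ t) (htr : t ≤ r) (z : ℝ)
    {h : (Iic s → ℝ) → ℝ≥0∞} (hh : Measurable h) {g : ℝ → ℝ≥0∞} (hg : Measurable g) :
    ∫⁻ ω, h (fun u => brownianBridge W (fun _ => r) (fun _ => z) u ω)
        * g (brownianBridge W (fun _ => r) (fun _ => z) t ω) ∂P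
      = ∫⁻ ω, bridgeExpectation P W s h (brownianBridge W (fun _ => r) (fun _ => z) s ω)
        * g (brownianBridge W (fun _ => r) (fun _ => z) t ω) ∂P := by
  have := hW.isGaussianProcess.isProbabilityMeasure
  let U : Ω → Iic s → ℝ := fun ω u => W u ω - ((u : ℝ≥0) : ℝ) / s * W s ω
  let V : Ω → Ici s → ℝ := fun ω v => W v ω
  have hU : Measurable U := measurable_pi_lambda _ fun u => by fun_prop
  have hV : Measurable V := measurable_pi_lambda _ fun u => by fun_prop
  let b (v : Ici s) (w : Ici s → ℝ) : ℝ :=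
    w v - ((v : ℝ≥0) : ℝ) / r * w ⟨r, hst.trans htr⟩ + ((v : ℝ≥0) : ℝ) / r * z
  have hb (v : Ici s) : Measurable (b v) := by fun_prop
  -- The past path is rebuilt from the independent part `U` and the value at `s`. That value and the
  -- argument of `g` depend on `V` alone, so integrating out `U` leaves `bridgeExpectation`.
  let f : (Ici s → ℝ) × (Iic s → ℝ) → ℝ≥0∞ := fun q =>
    h (fun u => q.2 u + ((u : ℝ≥0) : ℝ) / s * b ⟨s, self_mem_Ici⟩ q.1) * g (b ⟨t, hst⟩ q.1)
  have hf : Measurable f := by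
    refine (hh.comp ?_).mul (hg.comp ((hb _).comp measurable_fst))
    refine measurable_pi_lambda _ fun u => ?_
    have := (hb ⟨s, self_mem_Ici⟩).comp
      (measurable_fst : Measurable fun q : (Ici s → ℝ) × (Iic s → ℝ) => q.1)
    fun_prop
  have hbs (ω : Ω) : b ⟨s, self_mem_Ici⟩ (V ω) = brownianBridge W (fun _ => r) (fun _ => z) s ω :=
    (brownianBridge_const_of_le (hst.trans htr) z ω).symm
  have hbt (ω : Ω) : b ⟨t, hst⟩ (V ω) = brownianBridge W (fun _ => r) (fun _ => z) t ω :=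
    (brownianBridge_const_of_le htr z ω).symm
  have key := lintegral_indepFun_eq_lintegral_lintegral (indepFun_sub_div_mul hW hs).symm hV hU hf
  have hl : Measurable (fun x => ∫⁻ ω, f (x, U ω) ∂P) :=
    Measurable.lintegral_prod_right' (f := fun q : (Ici s → ℝ) × Ω => f (q.1, U q.2))
      (hf.comp (measurable_fst.prodMk (hU.comp measurable_snd)))
  rw [lintegral_map hl hV] at key
  convert key using 1
  · refine lintegral_congr fun ω => ?_
    change _ = h (fun u => U ω u + ((u : ℝ≥0) : ℝ) / s * b ⟨s, self_mem_Ici⟩ (V ω))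
      * g (b ⟨t, hst⟩ (V ω))
    simp only [hbs, hbt]
    congr 2
    ext u
    rw [brownianBridge_const_eq_brownianBridge_const hs (hst.trans htr) u.2,
      brownianBridge_const_of_le u.2]
  · refine lintegral_congr fun ω => ?_
    simp only [f, hbs, hbt]
    rw [lintegral_mul_const]
    · congr 1
      refine lintegral_congr fun ω' => ?_
      congr 1
      ext u
      rw [brownianBridge_const_of_le u.2]
    · refine hh.comp (measurable_pi_lambda _ fun u => ?_)
      fun_prop

theorem measurable_bridgePDF (t : ℝ≥0) {α : Type*} [MeasurableSpace α] {r : α → ℝ≥0}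
    {z x : α → ℝ} (hr : Measurable r) (hz : Measurable z) (hx : Measurable x) :
    Measurable (fun a => bridgePDF (r a) (z a) t (x a)) := by
  have : Measurable fun a => (((t : ℝ) / (r a : ℝ) * z a, t * (r a - t) / r a, x a) :
    ℝ × ℝ≥0 × ℝ) := by fun_prop
  exact measurable_uncurry_gaussianPDF.comp this

theorem lintegral_brownianBridge_const (hW : IsPreBrownianReal W P)
    (hWm : ∀ t, Measurable (W t)) {r s : ℝ≥0} (hs : 0 < s) (hsr : s < r) (z : ℝ)
    {h : (Iic s → ℝ) → ℝ≥0∞} (hh : Measurable h) {g : ℝ → ℝ≥0∞} (hg : Measurable g) :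
    ∫⁻ ω, h (fun u => brownianBridge W (fun _ => r) (fun _ => z) u ω)
        * g (brownianBridge W (fun _ => r) (fun _ => z) s ω) ∂P
      = ∫⁻ x, bridgePDF r z s x * (bridgeExpectation P W s h x * g x) := by
  have := hW.isGaussianProcess.isProbabilityMeasure
  rw [lintegral_brownianBridge_const_mul hW hWm hs le_rfl hsr.le z hh hg]
  have hm : Measurable fun x => bridgeExpectation P W s h x * g x :=
    (measurable_bridgeExpectation hWm hh).mul hg
  have := lintegral_map (μ := P) hm (measurable_brownianBridge_const hWm r z s)
  rw [← this, map_brownianBridge_const hW hWm hs hsr,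
    lintegral_withDensity_eq_lintegral_mul _
      (show Measurable (bridgePDF _ _ s) from measurable_gaussianPDF _ _) hm]
  rfl

/-- Up to time `t` the bridge is a bridge of length `t` pinned at its value `y` there, so given `y`
its value at `s` has density `bridgePDF t y s`. All dependence on `r` and `z` is left in the law of
`y`. -/
theorem lintegral_brownianBridge_const_two (hW : IsPreBrownianReal W P)
    (hWm : ∀ t, Measurable (W t)) {r s t : ℝ≥0} (hs : 0 < s) (hst : s < t) (htr : t < r) (z : ℝ)
    {h : (Iic s → ℝ) → ℝ≥0∞} (hh : Measurable h) {g : ℝ → ℝ≥0∞} (hg : Measurable g) :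
    ∫⁻ ω, h (fun u => brownianBridge W (fun _ => r) (fun _ => z) u ω)
        * g (brownianBridge W (fun _ => r) (fun _ => z) t ω) ∂P
      = ∫⁻ y, bridgePDF r z t y *
          ((∫⁻ x, bridgePDF t y s x * bridgeExpectation P W s h x) * g y) := by
  have := hW.isGaussianProcess.isProbabilityMeasure
  rw [lintegral_brownianBridge_const_mul hW hWm hs hst.le htr.le z hh hg]
  have hm := measurable_bridgeExpectation (P := P) hWm hh
  -- The functional `H(w_s)` of the past before `s` is itself a functional of the path on `[0, t]`.
  have key := lintegral_brownianBridge_const hW hWm (hs.trans hst) htr z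
    (h := fun w => bridgeExpectation P W s h (w ⟨s, hst.le⟩)) (by fun_prop) hg
  rw [key]
  refine lintegral_congr fun y => ?_
  congr 2
  have := lintegral_map (μ := P) hm (measurable_brownianBridge_const hWm t y s)
  rw [map_brownianBridge_const hW hWm hs hst,
    lintegral_withDensity_eq_lintegral_mul _
      (show Measurable (bridgePDF _ _ s) from measurable_gaussianPDF _ _) hm] at this
  exact this.symm

end FixedLength

/-! ### Mixing over the random length and pinning point. -/

section Mixture

variable {Ω : Type*} [mΩ : MeasurableSpace Ω] {P : Measure Ω}
  {W : ℝ≥0 → Ω → ℝ} {τ : Ω → ℝ≥0} {Z : Ω → ℝ} {z : Fin 2 → ℝ} {p : Fin 2 → ℝ≥0}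

theorem ae_mem_pair [IsProbabilityMeasure P] (hZ : Measurable Z) (hz : z 0 ≠ z 1)
    (hp : p 0 + p 1 = 1) (hZlaw : ∀ i, P (Z ⁻¹' {z i}) = p i) :
    ∀ᵐ ω ∂P, Z ω = z 0 ∨ Z ω = z 1 := by
  have h1 : P (Z ⁻¹' {z 0} ∪ Z ⁻¹' {z 1}) = 1 := by
    rw [measure_union _ (hZ (measurableSet_singleton _)), hZlaw, hZlaw]
    · exact_mod_cast hp
    · exact Disjoint.preimage _ (by simpa using hz)
  have h2 := (prob_compl_eq_zero_iff ((hZ (measurableSet_singleton _)).union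
    (hZ (measurableSet_singleton _)))).2 h1
  filter_upwards [measure_eq_zero_iff_ae_notMem.1 h2] with ω hω
  simpa [imp_iff_not_or] using hω

theorem lintegral_map_pair [IsProbabilityMeasure P] (hZ : Measurable Z) (hz : z 0 ≠ z 1)
    (hp : p 0 + p 1 = 1) (hZlaw : ∀ i, P (Z ⁻¹' {z i}) = p i) (f : ℝ → ℝ≥0∞) :
    ∫⁻ x, f x ∂(P.map Z) = ∑ i, p i * f (z i) := by
  have h1 : ∀ᵐ x ∂(P.map Z), x ∈ ({z 0, z 1} : Set ℝ) := by
    rw [ae_map_iff hZ.aemeasurable (by measurability)]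
    simpa using ae_mem_pair hZ hz hp hZlaw
  have h2 (i : Fin 2) : P.map Z {z i} = p i := by
    rw [Measure.map_apply hZ (measurableSet_singleton _), hZlaw]
  rw [← Measure.restrict_eq_self_of_ae_mem h1, ← singleton_union,
    lintegral_union (measurableSet_singleton _) (by simpa using hz)]
  simp [h2]
  rfl

/-- Conditioning on the length and on the pinning point. -/
theorem setLIntegral_brownianBridge [IsProbabilityMeasure P]
    (hWm : ∀ t, Measurable (W t)) (hWc : ∀ ω, Continuous (fun t => W t ω))
    (hτ : Measurable τ) (hZ : Measurable Z) (hind : IndepFun τ Z P)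
    (hindW : IndepFun (fun ω => (τ ω, Z ω)) (fun ω t => W t ω) P)
    (hz : z 0 ≠ z 1) (hp : p 0 + p 1 = 1) (hZlaw : ∀ i, P (Z ⁻¹' {z i}) = p i)
    {A : Set ℝ≥0} (hA : MeasurableSet A) {Φ : (ℝ≥0 → ℝ) → ℝ≥0∞} (hΦ : Measurable Φ) :
    ∫⁻ ω in τ ⁻¹' A, Φ (fun t => brownianBridge W τ Z t ω) ∂P
      = ∑ i, (p i : ℝ≥0∞) * ∫⁻ r in A, ∫⁻ ω,
          Φ (fun t => brownianBridge W (fun _ => r) (fun _ => z i) t ω) ∂P ∂(P.map τ) := by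
  -- Evaluating a path at a random time is jointly measurable on continuous paths, but not on the
  -- full product space. Both path maps generate the same σ-algebra on `Ω`, so independence carries
  -- over.
  let C := {w : ℝ≥0 → ℝ // Continuous w}
  let Y : Ω → C := fun ω => ⟨fun t => W t ω, hWc ω⟩
  have hY : Measurable Y := (measurable_pi_lambda _ hWm).subtype_mk
  have hindY : IndepFun (fun ω => (τ ω, Z ω)) Y P := by
    rw [IndepFun_iff_Indep] at hindW ⊢
    have : MeasurableSpace.comap Y inferInstance
        = MeasurableSpace.comap (fun ω t => W t ω) inferInstance := by
      change MeasurableSpace.comap Y (MeasurableSpace.comap Subtype.val _) = _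
      rw [MeasurableSpace.comap_comp]
      rfl
    rwa [this]
  let b : (ℝ≥0 × ℝ) × C → ℝ≥0 → ℝ := fun q t =>
    brownianBridge (fun t (q : (ℝ≥0 × ℝ) × C) => q.2.1 t) (fun q => q.1.1) (fun q => q.1.2) t q
  have hb : Measurable b := measurable_pi_lambda _ fun t =>
    measurable_brownianBridge
      (fun t => (measurable_pi_apply t).comp (measurable_subtype_coe.comp measurable_snd))
      (fun q => q.2.2) (by fun_prop) (by fun_prop) t
  let f : (ℝ≥0 × ℝ) × C → ℝ≥0∞ := fun q => A.indicator (fun _ => 1) q.1.1 * Φ (b q)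
  have hf : Measurable f :=
    ((measurable_const.indicator hA).comp (by fun_prop)).mul (hΦ.comp hb)
  have key := lintegral_indepFun_eq_lintegral_lintegral hindY (hτ.prodMk hZ) hY hf
  have hl : Measurable (fun x => ∫⁻ ω, f (x, Y ω) ∂P) :=
    Measurable.lintegral_prod_right' (f := fun q : (ℝ≥0 × ℝ) × Ω => f (q.1, Y q.2))
      (hf.comp (measurable_fst.prodMk (hY.comp measurable_snd)))
  have hl2 (x : ℝ) : Measurable fun r => ∫⁻ ω, f ((r, x), Y ω) ∂P :=
    hl.comp (measurable_id.prodMk measurable_const)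
  rw [(indepFun_iff_map_prod_eq_prod_map_map hτ.aemeasurable hZ.aemeasurable).1 hind,
    lintegral_prod _ hl.aemeasurable] at key
  simp_rw [lintegral_map_pair hZ hz hp hZlaw] at key
  rw [lintegral_finsetSum _ fun i _ => (hl2 _).const_mul _] at key
  simp_rw [lintegral_const_mul _ (hl2 _)] at key
  rw [← lintegral_indicator (hτ hA)]
  convert key using 1
  · refine lintegral_congr fun ω => ?_
    by_cases h : τ ω ∈ A
    · rw [indicator_of_mem (show ω ∈ τ ⁻¹' A from h)]
      simp only [f, indicator_of_mem h, one_mul]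
      rfl
    · rw [indicator_of_notMem (show ω ∉ τ ⁻¹' A from h)]
      simp only [f, indicator_of_notMem h, zero_mul]
  · refine Finset.sum_congr rfl fun i _ => ?_
    rw [← lintegral_indicator hA]
    congr 1
    refine lintegral_congr fun r => ?_
    by_cases h : r ∈ A
    · simp only [f, indicator_of_mem h, one_mul]
      rfl
    · simp [f, indicator_of_notMem h]

/-- Tonelli. `F` may depend on `i` because a bridge that has ended contributes `g (z i)`. -/
theorem sum_lintegral_bridgePDF_mul (ν : Measure ℝ≥0) [SFinite ν] (z : Fin 2 → ℝ)
    (p : Fin 2 → ℝ≥0) (s : ℝ≥0) (A : Set ℝ≥0) {F : Fin 2 → ℝ → ℝ≥0∞}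
    (hF : ∀ i, Measurable (F i)) :
    ∑ i, (p i : ℝ≥0∞) * ∫⁻ r in A, (∫⁻ x, bridgePDF r (z i) s x * F i x) ∂ν
      = ∫⁻ x, ∑ i, (p i : ℝ≥0∞) * (∫⁻ r in A, bridgePDF r (z i) s x ∂ν) * F i x := by
  have hm (i : Fin 2) : Measurable fun q : ℝ≥0 × ℝ => bridgePDF q.1 (z i) s q.2 :=
    measurable_bridgePDF s measurable_fst measurable_const measurable_snd
  have hI (i : Fin 2) : Measurable fun x => ∫⁻ r in A, bridgePDF r (z i) s x ∂ν :=
    (hm i).lintegral_prod_left'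
  rw [lintegral_finsetSum _ fun i _ => by fun_prop]
  refine Finset.sum_congr rfl fun i _ => ?_
  simp_rw [mul_assoc]
  rw [lintegral_const_mul _ (by fun_prop), lintegral_lintegral_swap]
  · congr 1
    refine lintegral_congr fun x => ?_
    rw [lintegral_mul_const]
    exact measurable_bridgePDF s measurable_id measurable_const measurable_const
  · exact ((hm i).mul ((hF i).comp measurable_snd)).aemeasurable

theorem measurable_aliveDensity (ν : Measure ℝ≥0) [SFinite ν] (z : Fin 2 → ℝ)
    (p : Fin 2 → ℝ≥0) (s : ℝ≥0) : Measurable (aliveDensity ν z p s) := by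
  unfold aliveDensity
  refine Finset.measurable_sum _ fun i _ => Measurable.const_mul ?_ _
  exact (measurable_bridgePDF s measurable_fst measurable_const
    measurable_snd).lintegral_prod_left'

/-- The unnormalized expectation of `g` at time `t`, given that at time `s` the process is still
alive and sits at `x`. -/
def transitionNumerator (ν : Measure ℝ≥0) (z : Fin 2 → ℝ) (p : Fin 2 → ℝ≥0) (s t : ℝ≥0)
    (g : ℝ → ℝ≥0∞) (x : ℝ) : ℝ≥0∞ :=
  ∑ i, (p i : ℝ≥0∞) * (∫⁻ r in Ioc s t, bridgePDF r (z i) s x ∂ν) * g (z i)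
    + ∫⁻ y, bridgePDF t y s x * (aliveDensity ν z p t y * g y)

variable [IsProbabilityMeasure P] (hW : IsPreBrownianReal W P)
    (hWm : ∀ t, Measurable (W t)) (hWc : ∀ ω, Continuous (fun t => W t ω))
    (hτ : Measurable τ) (hZ : Measurable Z) (hind : IndepFun τ Z P)
    (hindW : IndepFun (fun ω => (τ ω, Z ω)) (fun ω t => W t ω) P)
    (hz : z 0 ≠ z 1) (hp : p 0 + p 1 = 1) (hZlaw : ∀ i, P (Z ⁻¹' {z i}) = p i)
    {s t : ℝ≥0} (hs : 0 < s) {h : (Iic s → ℝ) → ℝ≥0∞} (hh : Measurable h)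
    {g : ℝ → ℝ≥0∞} (hg : Measurable g)

include hW hWm hWc hτ hZ hind hindW hz hp hZlaw hs hh hg

/-- Since `bridgeExpectation` is the same for every length and pinning point, mixing affects only
the density of the value at `s`. -/
theorem setLIntegral_Ioi_present :
    ∫⁻ ω in τ ⁻¹' Ioi s, h (fun u => brownianBridge W τ Z u ω) * g (brownianBridge W τ Z s ω) ∂P
      = ∫⁻ x, aliveDensity (P.map τ) z p s x * (bridgeExpectation P W s h x * g x) := by
  have := setLIntegral_brownianBridge hWm hWc hτ hZ hind hindW hz hp hZlaw
    (measurableSet_Ioi (a := s)) (Φ := fun w => h (fun u => w u) * g (w s)) (by fun_prop)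
  rw [this]
  have h2 : ∀ i, ∫⁻ r in Ioi s, ∫⁻ ω, h (fun u => brownianBridge W (fun _ => r) (fun _ => z i) u ω)
        * g (brownianBridge W (fun _ => r) (fun _ => z i) s ω) ∂P ∂(P.map τ)
      = ∫⁻ r in Ioi s, (∫⁻ x, bridgePDF r (z i) s x *
          (bridgeExpectation P W s h x * g x)) ∂(P.map τ) := fun i =>
    setLIntegral_congr_fun measurableSet_Ioi fun r hr =>
      lintegral_brownianBridge_const hW hWm hs hr (z i) hh hg
  simp_rw [h2]
  rw [sum_lintegral_bridgePDF_mul (P.map τ) z p s (Ioi s)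
    (F := fun _ x => bridgeExpectation P W s h x * g x)
    fun _ => (measurable_bridgeExpectation hWm hh).mul hg]
  simp_rw [← Finset.sum_mul]
  rfl

/-- If `s < τ ≤ t`, the value at `t` is the pinning point and only the law at `s` matters. If `τ >
t`, the two-time formula applies and Tonelli brings the integral over the value at `s` outside. Both
pieces carry the same factor `bridgeExpectation`. -/
theorem setLIntegral_Ioi_future (hst : s < t) :
    ∫⁻ ω in τ ⁻¹' Ioi s, h (fun u => brownianBridge W τ Z u ω) * g (brownianBridge W τ Z t ω) ∂P
      = ∫⁻ x, bridgeExpectation P W s h x * transitionNumerator (P.map τ) z p s t g x := by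
  have hH := measurable_bridgeExpectation (P := P) hWm hh
  have hmix {A : Set ℝ≥0} (hA : MeasurableSet A) :=
    setLIntegral_brownianBridge hWm hWc hτ hZ hind hindW hz hp hZlaw
    hA (Φ := fun w => h (fun u => w u) * g (w t)) (by fun_prop)
  have e1 : ∫⁻ ω in τ ⁻¹' Ioc s t, h (fun u => brownianBridge W τ Z u ω)
        * g (brownianBridge W τ Z t ω) ∂P
      = ∫⁻ x, ∑ i, (p i : ℝ≥0∞) * (∫⁻ r in Ioc s t, bridgePDF r (z i) s x ∂(P.map τ)) *
        (bridgeExpectation P W s h x * g (z i)) := by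
    rw [hmix measurableSet_Ioc, ← sum_lintegral_bridgePDF_mul (P.map τ) z p s (Ioc s t)
      (F := fun i x => bridgeExpectation P W s h x * g (z i)) fun i => hH.mul_const _]
    refine Finset.sum_congr rfl fun i _ => ?_
    congr 1
    refine setLIntegral_congr_fun measurableSet_Ioc fun r hr => ?_
    simp only
    rw [← lintegral_brownianBridge_const hW hWm hs hr.1 (z i) hh (g := fun _ => g (z i))
      measurable_const]
    refine lintegral_congr fun ω => ?_
    rw [brownianBridge_of_ge (t := t) (hs.trans hr.1) hr.2]
  have e2 : ∫⁻ ω in τ ⁻¹' Ioi t, h (fun u => brownianBridge W τ Z u ω)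
        * g (brownianBridge W τ Z t ω) ∂P
      = ∫⁻ x, bridgeExpectation P W s h x *
          ∫⁻ y, bridgePDF t y s x * (aliveDensity (P.map τ) z p t y * g y) := by
    have hm : Measurable fun q : ℝ × ℝ => bridgePDF t q.1 s q.2 :=
      measurable_bridgePDF s measurable_const measurable_fst measurable_snd
    have hi : Measurable fun y => ∫⁻ x, bridgePDF t y s x * bridgeExpectation P W s h x :=
      Measurable.lintegral_prod_right'
        (f := fun q : ℝ × ℝ => bridgePDF t q.1 s q.2 * bridgeExpectation P W s h q.2)
        (hm.mul (hH.comp measurable_snd))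
    have hD := measurable_aliveDensity (P.map τ) z p t
    have h2 : ∀ i, ∫⁻ r in Ioi t, ∫⁻ ω,
          h (fun u => brownianBridge W (fun _ => r) (fun _ => z i) u ω)
          * g (brownianBridge W (fun _ => r) (fun _ => z i) t ω) ∂P ∂(P.map τ)
        = ∫⁻ r in Ioi t, (∫⁻ y, bridgePDF r (z i) t y *
          ((∫⁻ x, bridgePDF t y s x * bridgeExpectation P W s h x) * g y)) ∂(P.map τ) := fun i =>
      setLIntegral_congr_fun measurableSet_Ioi fun r hr =>
        lintegral_brownianBridge_const_two hW hWm hs hst hr (z i) hh hg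
    rw [hmix measurableSet_Ioi]
    simp_rw [h2]
    rw [sum_lintegral_bridgePDF_mul (P.map τ) z p t (Ioi t)
      (F := fun _ y => (∫⁻ x, bridgePDF t y s x * bridgeExpectation P W s h x) * g y)
      fun _ => hi.mul hg]
    simp_rw [← Finset.sum_mul]
    change ∫⁻ y, aliveDensity (P.map τ) z p t y * _ = _
    have hmy (y : ℝ) : Measurable fun x => bridgePDF t y s x * bridgeExpectation P W s h x :=
      (hm.comp measurable_prodMk_left).mul hH
    have hmx (x : ℝ) : Measurable fun y =>
        bridgePDF t y s x * (aliveDensity (P.map τ) z p t y * g y) :=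
      (hm.comp measurable_prodMk_right).mul (hD.mul hg)
    have e (y : ℝ) : aliveDensity (P.map τ) z p t y *
          ((∫⁻ x, bridgePDF t y s x * bridgeExpectation P W s h x) * g y)
        = ∫⁻ x, bridgeExpectation P W s h x *
          (bridgePDF t y s x * (aliveDensity (P.map τ) z p t y * g y)) := by
      rw [← lintegral_mul_const _ (hmy y), ← lintegral_const_mul _ ((hmy y).mul_const _)]
      exact lintegral_congr fun x => by ring
    simp_rw [e, ← lintegral_const_mul _ (hmx _)]
    rw [lintegral_lintegral_swap]
    exact ((hH.comp measurable_snd).mul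
      (hm.mul ((hD.mul hg).comp measurable_fst))).aemeasurable
  have hunion : τ ⁻¹' Ioi s = τ ⁻¹' Ioc s t ∪ τ ⁻¹' Ioi t := by
    rw [← preimage_union, Ioc_union_Ioi_eq_Ioi hst.le]
  have hI (i : Fin 2) :
      Measurable fun x => ∫⁻ r in Ioc s t, bridgePDF r (z i) s x ∂(P.map τ) :=
    (measurable_bridgePDF s measurable_fst measurable_const measurable_snd).lintegral_prod_left'
  rw [hunion, lintegral_union (hτ measurableSet_Ioi), e1, e2, ← lintegral_add_left]
  · refine lintegral_congr fun x => ?_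
    rw [transitionNumerator, mul_add, Finset.mul_sum]
    congr 1
    exact Finset.sum_congr rfl fun i _ => by ring
  · exact Finset.measurable_sum _ fun i _ => ((hI i).const_mul _).mul (hH.mul_const _)
  · exact Disjoint.preimage _ (Ioc_disjoint_Ioi le_rfl)

end Mixture

/-! ### The transition kernel. -/

/-- Bayes' rule for Brownian motion: both sides are the density at `x` of `W_s` given `W_t = y`. -/
theorem gaussianPDF_mul_div_eq_bridgePDF {s t : ℝ≥0} (hs : 0 < s) (hst : s < t) (x y : ℝ) :
    gaussianPDF 0 (t - s) (y - x) * (gaussianPDF 0 s x / gaussianPDF 0 t y)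
      = bridgePDF t y s x := by
  have hs' : (0 : ℝ) < s := by exact_mod_cast hs
  have ht' : (0 : ℝ) < t := by exact_mod_cast hs.trans hst
  have hts : (0 : ℝ) < t - s := by simpa using hst
  have ht0 : t ≠ 0 := (hs.trans hst).ne'
  have h : gaussianPDFReal 0 (t - s) (y - x) * gaussianPDFReal 0 s x
      = gaussianPDFReal ((s : ℝ) / t * y) (s * (t - s) / t) x * gaussianPDFReal 0 t y := by
    simp only [gaussianPDFReal]
    push_cast [NNReal.coe_sub hst.le]
    rw [mul_mul_mul_comm, mul_mul_mul_comm (√(2 * Real.pi * (s * (t - s) / t)))⁻¹,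
      ← Real.exp_add, ← Real.exp_add, ← mul_inv,
      ← mul_inv, ← Real.sqrt_mul (by positivity), ← Real.sqrt_mul (by positivity)]
    congr 2
    · congr 1
      field_simp
    · field_simp
      ring
  rw [← mul_div_assoc, bridgePDF]
  symm
  rw [ENNReal.eq_div_iff (gaussianPDF_pos _ ht0 _).ne' gaussianPDF_ne_top, mul_comm]
  simp only [gaussianPDF]
  rw [← ENNReal.ofReal_mul (gaussianPDFReal_nonneg _ _ _),
    ← ENNReal.ofReal_mul (gaussianPDFReal_nonneg _ _ _), h]

variable {ν : Measure ℝ≥0} {z : Fin 2 → ℝ} {p : Fin 2 → ℝ≥0} {s t : ℝ≥0}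

theorem measurable_transitionDensity [SFinite ν] (s t : ℝ≥0) :
    Measurable (Function.uncurry (transitionDensity ν z p s t)) := by
  have hx (a : ℝ) : MeasurableSet {q : ℝ × ℝ | q.1 = a} :=
    measurable_fst (measurableSet_singleton a)
  have hy (a : ℝ) : MeasurableSet {q : ℝ × ℝ | q.2 = a} :=
    measurable_snd (measurableSet_singleton a)
  have hD (u : ℝ≥0) := measurable_aliveDensity ν z p u
  have hg (v : ℝ≥0) := measurable_gaussianPDF 0 v
  have hI (i : Fin 2) : Measurable fun x => ∫⁻ r in Ioc s t, bridgePDF r (z i) s x ∂ν :=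
    (measurable_bridgePDF s measurable_fst measurable_const measurable_snd).lintegral_prod_left'
  unfold transitionDensity Function.uncurry
  refine Measurable.add (Finset.measurable_sum _ fun i _ => Measurable.mul (Measurable.add ?_ ?_)
    ?_) ?_
  · exact Measurable.ite (hx _) measurable_const measurable_const
  · refine Measurable.ite ((hx _).compl.inter (hx _).compl) ?_ measurable_const
    exact (((hI i).comp measurable_fst).const_mul _).div ((hD s).comp measurable_fst)
  · exact Measurable.ite (hy _) measurable_const measurable_const
  · refine Measurable.ite ((hx _).compl.inter ((hx _).compl.inter
      ((hy _).compl.inter (hy _).compl))) ?_ measurable_const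
    fun_prop

/-- The transition measures, as a kernel. -/
def transitionKernel (ν : Measure ℝ≥0) (z : Fin 2 → ℝ) (p : Fin 2 → ℝ≥0) (s t : ℝ≥0) :
    Kernel ℝ ℝ :=
  Kernel.withDensity (Kernel.const ℝ (Measure.dirac (z 0) + Measure.dirac (z 1) + volume))
    (transitionDensity ν z p s t)

theorem transitionKernel_apply [SFinite ν] (x : ℝ) :
    transitionKernel ν z p s t x = (Measure.dirac (z 0) + Measure.dirac (z 1) +
      volume).withDensity (transitionDensity ν z p s t x) := by
  rw [transitionKernel, Kernel.withDensity_apply _ (measurable_transitionDensity s t),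
    Kernel.const_apply]

theorem lintegral_transitionKernel [SFinite ν] {g : ℝ → ℝ≥0∞} (hg : Measurable g) (x : ℝ) :
    ∫⁻ y, g y ∂(transitionKernel ν z p s t x)
      = ∑ i, transitionDensity ν z p s t x (z i) * g (z i)
        + ∫⁻ y, transitionDensity ν z p s t x y * g y := by
  rw [transitionKernel, Kernel.lintegral_withDensity _ (measurable_transitionDensity s t) _ hg,
    Kernel.const_apply, lintegral_add_measure, lintegral_add_measure, lintegral_dirac,
    lintegral_dirac, Fin.sum_univ_two]

/-- Once the process has reached a pinning point it stays there. -/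
theorem lintegral_transitionKernel_pinned [SFinite ν] (hz : z 0 ≠ z 1) {g : ℝ → ℝ≥0∞}
    (hg : Measurable g) {x : ℝ} (hx : x = z 0 ∨ x = z 1) :
    ∫⁻ y, g y ∂(transitionKernel ν z p s t x) = g x := by
  rw [lintegral_transitionKernel hg]
  -- From a pinning point the density is supported on the two atoms, which Lebesgue measure ignores.
  have h0 : ∫⁻ y, transitionDensity ν z p s t x y * g y = 0 := by
    rw [lintegral_eq_zero_iff]
    · filter_upwards [volume.ae_ne (z 0), volume.ae_ne (z 1)] with y h0 h1
      rcases hx with rfl | rfl <;> simp [transitionDensity, h0, h1]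
    · exact (measurable_transitionDensity s t).of_uncurry_left.mul hg
  rw [h0, add_zero, Fin.sum_univ_two]
  rcases hx with rfl | rfl <;> simp [transitionDensity, hz, hz.symm]

/-- The atoms carry the event that the bridge ends in `(s, t]`; the Lebesgue part, rewritten by
Bayes' rule, carries survival past `t`. -/
theorem lintegral_transitionKernel_alive [SFinite ν] (hz : z 0 ≠ z 1) (hs : 0 < s) (hst : s < t)
    {g : ℝ → ℝ≥0∞} (hg : Measurable g) {x : ℝ} (hx0 : x ≠ z 0) (hx1 : x ≠ z 1) :
    ∫⁻ y, g y ∂(transitionKernel ν z p s t x)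
      = transitionNumerator ν z p s t g x / aliveDensity ν z p s x := by
  rw [lintegral_transitionKernel hg, transitionNumerator, ENNReal.add_div]
  have hB : Measurable fun y => bridgePDF t y s x :=
    measurable_bridgePDF s measurable_const measurable_id measurable_const
  have hD := measurable_aliveDensity ν z p t
  congr 1
  · rw [Fin.sum_univ_two, Fin.sum_univ_two, ENNReal.add_div]
    simp [transitionDensity, hx0, hx1, hz, hz.symm, Fin.sum_univ_two, ENNReal.div_eq_inv_mul]
    ring
  · rw [ENNReal.div_eq_inv_mul, ← lintegral_const_mul _ (by fun_prop)]
    refine lintegral_congr_ae ?_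
    filter_upwards [volume.ae_ne (z 0), volume.ae_ne (z 1)] with y h0 h1
    rw [← gaussianPDF_mul_div_eq_bridgePDF hs hst]
    simp [transitionDensity, hx0, hx1, h0, h1, ENNReal.div_eq_inv_mul]
    ring

/-- Gaussian densities are strictly positive and some `p i` is nonzero, so vanishing at a single
point already excludes lengths beyond `s`. -/
theorem measure_Ioi_eq_zero_of_aliveDensity_eq_zero [SFinite ν] (hp : p 0 + p 1 = 1)
    (hs : 0 < s) {x : ℝ} (h : aliveDensity ν z p s x = 0) : ν (Ioi s) = 0 := by
  obtain ⟨i, hi⟩ : ∃ i, p i ≠ 0 := by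
    by_contra! hc
    simp [hc] at hp
  have h1 : (p i : ℝ≥0∞) * ∫⁻ r in Ioi s, bridgePDF r (z i) s x ∂ν = 0 :=
    (Finset.sum_eq_zero_iff.1 h) i (Finset.mem_univ i)
  have h2 := (mul_eq_zero.1 h1).resolve_left (by simpa using hi)
  have h3 : Measurable fun r => bridgePDF r (z i) s x :=
    measurable_bridgePDF s measurable_id measurable_const measurable_const
  rw [setLIntegral_eq_zero_iff measurableSet_Ioi h3] at h2
  refine measure_eq_zero_iff_ae_notMem.2 ?_
  filter_upwards [h2] with r hr hrs
  have hv : s * (r - s) / r ≠ 0 := by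
    have : 0 < r - s := tsub_pos_of_lt hrs
    have : 0 < r := hs.trans hrs
    positivity
  exact (gaussianPDF_pos _ hv _).ne' (hr hrs)

theorem transitionNumerator_eq_zero [SFinite ν] (hst : s < t) (h : ν (Ioi s) = 0)
    (g : ℝ → ℝ≥0∞) (x : ℝ) : transitionNumerator ν z p s t g x = 0 := by
  have h1 : ν.restrict (Ioc s t) = 0 :=
    Measure.restrict_eq_zero.2 (measure_mono_null Ioc_subset_Ioi_self h)
  have h2 : ν.restrict (Ioi t) = 0 :=
    Measure.restrict_eq_zero.2 (measure_mono_null (Ioi_subset_Ioi hst.le) h)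
  simp [transitionNumerator, aliveDensity, h1, h2]

/-- Cancelling the denominator in `ℝ≥0∞` is problematic only at `0` and `∞`. At `0` the numerator
vanishes too; the value `∞` occurs only on a Lebesgue null set. -/
theorem aliveDensity_mul_lintegral_transitionKernel [SFinite ν] (hz : z 0 ≠ z 1)
    (hp : p 0 + p 1 = 1) (hs : 0 < s) (hst : s < t) {g : ℝ → ℝ≥0∞} (hg : Measurable g) {x : ℝ}
    (hx0 : x ≠ z 0) (hx1 : x ≠ z 1) (hD : aliveDensity ν z p s x ≠ ∞) :
    aliveDensity ν z p s x * ∫⁻ y, g y ∂(transitionKernel ν z p s t x)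
      = transitionNumerator ν z p s t g x := by
  rw [lintegral_transitionKernel_alive hz hs hst hg hx0 hx1]
  by_cases h : aliveDensity ν z p s x = 0
  · rw [transitionNumerator_eq_zero hst (measure_Ioi_eq_zero_of_aliveDensity_eq_zero hp hs h), h]
    simp
  · exact ENNReal.mul_div_cancel h hD

/-! ### The Markov identity and conditional distributions. -/

section RandomLength

variable {Ω : Type*} [mΩ : MeasurableSpace Ω] {P : Measure Ω} [IsProbabilityMeasure P]
  {W : ℝ≥0 → Ω → ℝ} {τ : Ω → ℝ≥0} {Z : Ω → ℝ}
    (hW : IsPreBrownianReal W P)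
    (hWm : ∀ t, Measurable (W t)) (hWc : ∀ ω, Continuous (fun t => W t ω))
    (hτ : Measurable τ) (hτpos : ∀ ω, 0 < τ ω) (hZ : Measurable Z) (hind : IndepFun τ Z P)
    (hindW : IndepFun (fun ω => (τ ω, Z ω)) (fun ω t => W t ω) P)
    (hz : z 0 ≠ z 1) (hp : p 0 + p 1 = 1) (hZlaw : ∀ i, P (Z ⁻¹' {z i}) = p i)
    (hs : 0 < s) (hst : s < t)

include hW hWm hWc hτ hZ hind hindW hz hp hZlaw hs

/-- Its integral is `P(τ > s)`, hence finite. -/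
theorem ae_aliveDensity_ne_top : ∀ᵐ x : ℝ, aliveDensity (P.map τ) z p s x ≠ ∞ := by
  have h := setLIntegral_Ioi_present hW hWm hWc hτ hZ hind hindW hz hp hZlaw hs
    (h := fun _ => 1) measurable_const (g := fun _ => 1) measurable_const
  simp only [bridgeExpectation, lintegral_const, measure_univ, mul_one] at h
  refine (ae_lt_top (measurable_aliveDensity _ z p s) ?_).mono fun x hx => hx.ne
  rw [← h]
  simp

include hτpos hst

/-- The Markov property of the bridge, in terms of its transition kernel. -/
theorem lintegral_brownianBridge_eq_lintegral_transitionKernel {h : (Iic s → ℝ) → ℝ≥0∞}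
    (hh : Measurable h) {g : ℝ → ℝ≥0∞} (hg : Measurable g) :
    ∫⁻ ω, h (fun u => brownianBridge W τ Z u ω) * g (brownianBridge W τ Z t ω) ∂P
      = ∫⁻ ω, h (fun u => brownianBridge W τ Z u ω) *
        ∫⁻ y, g y ∂(transitionKernel (P.map τ) z p s t (brownianBridge W τ Z s ω)) ∂P := by
  have hG : Measurable fun x => ∫⁻ y, g y ∂(transitionKernel (P.map τ) z p s t x) :=
    hg.lintegral_kernel
  have hA : MeasurableSet (τ ⁻¹' Ioi s) := hτ measurableSet_Ioi
  -- On `{τ > s}` both sides become Lebesgue integrals over the value at `s`, so the pinning points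
  -- can be discarded; on the complement the process is constant from `s` on.
  rw [← lintegral_add_compl _ hA, ← lintegral_add_compl (μ := P) (A := τ ⁻¹' Ioi s) _ hA]
  congr 1
  · rw [setLIntegral_Ioi_future hW hWm hWc hτ hZ hind hindW hz hp hZlaw hs hh hg hst,
      setLIntegral_Ioi_present hW hWm hWc hτ hZ hind hindW hz hp hZlaw hs hh hG]
    refine lintegral_congr_ae ?_
    filter_upwards [volume.ae_ne (z 0), volume.ae_ne (z 1),
      ae_aliveDensity_ne_top hW hWm hWc hτ hZ hind hindW hz hp hZlaw hs] with x h0 h1 hD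
    rw [← aliveDensity_mul_lintegral_transitionKernel hz hp hs hst hg h0 h1 hD]
    ring
  · refine lintegral_congr_ae ?_
    filter_upwards [ae_restrict_mem hA.compl, ae_restrict_of_ae (ae_mem_pair hZ hz hp hZlaw)]
      with ω hω hZω
    have hω' : τ ω ≤ s := not_lt.1 hω
    rw [brownianBridge_of_ge (hτpos ω) hω', brownianBridge_of_ge (hτpos ω) (hω'.trans hst.le),
      lintegral_transitionKernel_pinned hz hg hZω]

/-- A bridge observed along any statistic of the path on `[0, s]` that determines its value at
time `s` has the transition kernel as conditional distribution. -/
theorem condDistrib_brownianBridge {E : Type*} [MeasurableSpace E] {φ : (Iic s → ℝ) → E}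
    (hφ : Measurable φ) {e : E → ℝ} (he : Measurable e) (hφe : ∀ w, e (φ w) = w ⟨s, self_mem_Iic⟩) :
    ∀ᵐ q ∂(P.map fun ω => φ fun u => brownianBridge W τ Z u ω),
      condDistrib (brownianBridge W τ Z t) (fun ω => φ fun u => brownianBridge W τ Z u ω) P q
        = transitionKernel (P.map τ) z p s t (e q) := by
  have hξ := measurable_brownianBridge hWm hWc hτ hZ
  let R : Ω → Iic s → ℝ := fun ω u => brownianBridge W τ Z u ω
  have hR : Measurable R := measurable_pi_lambda _ fun u => hξ u
  have hX : Measurable fun ω => φ (R ω) := hφ.comp hR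
  have key {h : E → ℝ≥0∞} (hh : Measurable h) {g : ℝ → ℝ≥0∞} (hg : Measurable g) :
      ∫⁻ ω, h (φ (R ω)) * g (brownianBridge W τ Z t ω) ∂P
        = ∫⁻ ω, h (φ (R ω)) * ∫⁻ y, g y ∂(transitionKernel (P.map τ) z p s t (e (φ (R ω)))) ∂P := by
    have := lintegral_brownianBridge_eq_lintegral_transitionKernel hW hWm hWc hτ hτpos hZ hind
      hindW hz hp hZlaw hs hst (hh.comp hφ) hg
    simp_rw [hφe]
    exact this
  have hmass : Measurable fun q => transitionKernel (P.map τ) z p s t (e q) univ :=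
    (Kernel.measurable_coe _ MeasurableSet.univ).comp he
  -- The transition kernel is known to have mass one only almost everywhere (take `g = 1` in `key`).
  -- Replacing it by a Dirac mass off `S` gives a genuine Markov kernel, to which uniqueness of
  -- conditional distributions applies.
  let S : Set E := {q | transitionKernel (P.map τ) z p s t (e q) univ = 1}
  have hS : MeasurableSet S := hmass (measurableSet_singleton 1)
  have hRS : ∀ᵐ q ∂(P.map fun ω => φ (R ω)), q ∈ S := by
    refine ae_eq_of_forall_setLIntegral_eq_of_sigmaFinite hmass measurable_const fun A hA _ => ?_
    have := key (h := A.indicator 1) (measurable_one.indicator hA) (g := 1) measurable_one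
    simp only [Pi.one_apply, mul_one, lintegral_one] at this
    have e1 : Measurable fun q => A.indicator (1 : E → ℝ≥0∞) q *
        transitionKernel (P.map τ) z p s t (e q) univ := (measurable_one.indicator hA).mul hmass
    rw [← lintegral_map e1 hX, ← lintegral_map (measurable_one.indicator hA) hX] at this
    rw [← lintegral_indicator hA, ← lintegral_indicator hA]
    convert this.symm using 1
    · refine lintegral_congr fun q => ?_
      by_cases hq : q ∈ A <;> simp [hq]
    · rfl
  let κ : Kernel E ℝ := Kernel.piecewise hS
    ((transitionKernel (P.map τ) z p s t).comap e he) (Kernel.const _ (Measure.dirac 0))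
  have hκ : IsMarkovKernel κ := ⟨fun q => ⟨by
    by_cases hq : q ∈ S
    · rw [Kernel.piecewise_apply', if_pos hq, Kernel.comap_apply]
      exact hq
    · rw [Kernel.piecewise_apply', if_neg hq, Kernel.const_apply, measure_univ]⟩⟩
  have hκe : ∀ q ∈ S, κ q = transitionKernel (P.map τ) z p s t (e q) := fun q hq => by
    rw [Kernel.piecewise_apply, if_pos hq, Kernel.comap_apply]
  have hc : condDistrib (brownianBridge W τ Z t) (fun ω => φ (R ω)) P
      =ᵐ[P.map fun ω => φ (R ω)] κ := by
    refine condDistrib_ae_eq_of_measure_eq_compProd_of_measurable hX (hξ t) ?_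
    -- On a rectangle `A ×ˢ B` the required equality is `key` for the indicators of `A` and `B`.
    refine Measure.ext_prod fun {A B} hA hB => ?_
    rw [Measure.compProd_apply_prod hA hB, Measure.map_apply (hX.prodMk (hξ t)) (hA.prod hB)]
    have := key (h := A.indicator 1) (measurable_one.indicator hA) (g := B.indicator 1)
      (measurable_one.indicator hB)
    simp_rw [lintegral_indicator_one hB] at this
    have e1 : Measurable fun q => A.indicator (1 : E → ℝ≥0∞) q *
        transitionKernel (P.map τ) z p s t (e q) B :=
      (measurable_one.indicator hA).mul ((Kernel.measurable_coe _ hB).comp he)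
    rw [← lintegral_map e1 hX] at this
    rw [← lintegral_indicator_one ((hX.prodMk (hξ t)) (hA.prod hB)), ← lintegral_indicator hA]
    convert this using 1
    · refine lintegral_congr fun ω => ?_
      by_cases h1 : φ (R ω) ∈ A <;> by_cases h2 : brownianBridge W τ Z t ω ∈ B <;>
        simp [indicator, h1, h2]
    · refine lintegral_congr_ae ?_
      filter_upwards [hRS] with q hq
      rw [← hκe q hq]
      by_cases h1 : q ∈ A <;> simp [h1]
  filter_upwards [hc, hRS] with q hq hqS
  rw [← hκe q hqS, ← hq]

end RandomLength

end BrownianBridge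

end

/-! ### Markov property and transition law. -/

theorem mainTheorem7 {Ω : Type*} [mΩ : MeasurableSpace Ω] (P : Measure Ω)
    [IsProbabilityMeasure P]
    (W : ℝ≥0 → Ω → ℝ) (τ : Ω → ℝ≥0) (Z : Ω → ℝ)
    (hW : IsPreBrownianReal W P) (hWm : ∀ t, Measurable (W t))
    (hWc : ∀ ω, Continuous (fun t => W t ω))
    (hτ : Measurable τ) (hτpos : ∀ ω, 0 < τ ω) (hZ : Measurable Z)
    (hind : IndepFun τ Z P)
    (hindW : IndepFun (fun ω => (τ ω, Z ω)) (fun ω t => W t ω) P)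
    (z : Fin 2 → ℝ) (hz : z 0 ≠ z 1)
    (p : Fin 2 → ℝ≥0) (hp : p 0 + p 1 = 1)
    (hZlaw : ∀ i, P (Z ⁻¹' {z i}) = p i) :
    IsMarkovProcess
        (Filtration.natural (brownianBridge W τ Z)
          (fun t => (measurable_brownianBridge hWm hWc hτ hZ t).stronglyMeasurable))
        (brownianBridge W τ Z) P ∧
      ∀ t u : ℝ≥0, 0 < t → t < u →
        ∀ᵐ x ∂(P.map (brownianBridge W τ Z t)),
          condDistrib (brownianBridge W τ Z u) (brownianBridge W τ Z t) P x =
            (Measure.dirac (z 0) + Measure.dirac (z 1) + volume).withDensity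
              (transitionDensity (P.map τ) z p t u x) := by
  have hξ := measurable_brownianBridge hWm hWc hτ hZ
  have hker {t u : ℝ≥0} (ht : 0 < t) (htu : t < u) :=
    BrownianBridge.condDistrib_brownianBridge hW hWm hWc hτ hτpos hZ hind hindW hz hp hZlaw ht htu
      (φ := fun w => w ⟨t, self_mem_Iic⟩) (by fun_prop) measurable_id fun _ => rfl
  refine ⟨⟨fun t => (comap_measurable _).mono (le_iSup₂_of_le t le_rfl le_rfl) le_rfl, ?_⟩,
    fun t u ht htu => ?_⟩
  · rintro s t hst g hg ⟨C, hC⟩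
    have hint : Integrable (fun ω => g (brownianBridge W τ Z t ω)) P :=
      Integrable.of_bound (hg.comp (hξ t)).aestronglyMeasurable C (ae_of_all _ fun ω => hC _)
    -- The kernel needs `0 < s < t`. At `s = 0` the two σ-algebras coincide, and at `s = t` the
    -- variable is measurable for both.
    rcases eq_or_ne s 0 with rfl | hs0
    · have : Filtration.natural (brownianBridge W τ Z) (fun t => (hξ t).stronglyMeasurable) 0
          = MeasurableSpace.comap (brownianBridge W τ Z 0) inferInstance := by
        simp [Filtration.natural]
      rw [this]
    rcases hst.eq_or_lt with rfl | hst
    · have h1 : StronglyMeasurable[MeasurableSpace.comap (brownianBridge W τ Z s) inferInstance]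
          fun ω => g (brownianBridge W τ Z s ω) :=
        (hg.comp (comap_measurable _)).stronglyMeasurable
      have hle : MeasurableSpace.comap (brownianBridge W τ Z s) inferInstance
          ≤ Filtration.natural (brownianBridge W τ Z) (fun t => (hξ t).stronglyMeasurable) s :=
        le_iSup₂_of_le s le_rfl le_rfl
      rw [condExp_of_stronglyMeasurable (Filtration.le _ _) (h1.mono hle) hint,
        condExp_of_stronglyMeasurable (hξ s).comap_le h1 hint]
    have hs : 0 < s := pos_of_ne_zero hs0
    have hR : Measurable fun ω (u : Iic s) => brownianBridge W τ Z u ω :=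
      measurable_pi_lambda _ fun u => hξ u
    have h1 := condExp_ae_eq_integral_condDistrib hR (hξ t).aemeasurable hg.stronglyMeasurable hint
    have h2 := condExp_ae_eq_integral_condDistrib (hξ s) (hξ t).aemeasurable
      hg.stronglyMeasurable hint
    -- Conditioning on the whole past (`φ = id`) and on the present value alone gives the same
    -- kernel at `ξ_s`, hence equal conditional expectations.
    have h3 := ae_of_ae_map hR.aemeasurable <| BrownianBridge.condDistrib_brownianBridge hW hWm
      hWc hτ hτpos hZ hind hindW hz hp hZlaw hs hst (φ := id) measurable_id
      (e := fun w => w ⟨s, self_mem_Iic⟩) (by fun_prop) fun _ => rfl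
    have h4 := ae_of_ae_map (hξ s).aemeasurable (hker hs hst)
    rw [Filtration.natural_eq_comap]
    filter_upwards [h1, h2, h3, h4] with ω h1 h2 h3 h4
    rw [h1, h2, h4]
    simp only [id] at h3 ⊢
    rw [h3]
  · filter_upwards [hker ht htu] with x hx
    rw [hx, BrownianBridge.transitionKernel_apply]
    rfl
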